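/- **Definitions.** A *system* $(X,T)$ is a compact Hausdorff space $X$ with a homeomorphism $T:X\to X$. A point is *transitive* if its orbit $\{T^nx:n\in\mathbb Z\}$ is dense. The system is *recurrent-transitive* if it has a transitive point and $X$ has no isolated points. A *homomorphism* $\pi:(X,T)\to(Y,S)$ is a continuous surjection with $\pi T=S\pi$; then $(X,T)$ is called an extension of $(Y,S)$. It is *almost 1-1* if there is a dense $G_\delta$ set $X_0\subset X$ with $\pi^{-1}(\pi(x))=\{x\}$ for all $x\in X_0$. It is a *group-extension* if there is a compact subgroup $K$ of $\mathrm{Homeo}(X)$ (with the topology of uniform convergence), each element of which commutes with $T$, such that $\pi$ is, up to an isomorphism $(X/K,T)\cong(Y,S)$, the quotient map $X\to X/K$; then $(Y,S)$ is called a *compact group-factor* of $(X,T)$. Let $B(\mathbb Z)\subset\ell_\infty(\mathbb Z)$ be the set of Fourier–Stieltjes transforms $\hat\mu(n)=\int_{\mathbb T}e^{int}\,d\mu(t)$ of complex measures $\mu$ on the circle $\mathbb T=\mathbb R/2\pi\mathbb Z$, and let $H(\mathbb Z)$ be its closure in the norm of $\ell_\infty(\mathbb Z)$. A point-transitive system $(X,T)$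 is *Hilbert* if for some transitive point $x_0$ all the functions $n\mapsto F(T^nx_0)$, $F\in C(X)$, belong to $H(\mathbb Z)$. A metrizable system $(X,T)$ is *Hilbert-representable* if there are a complex Hilbert space $\mathcal H$, a unitary operator $U$ on $\mathcal H$ and a weakly compact $U$-invariant set $Z\subset\mathcal H$ such that $(X,T)$ is isomorphic to $(Z,U|_Z)$, where $Z$ carries the weak topology. **Theorem 3.1.** Let $(Y,T)$ be a metrizable recurrent-transitive Hilbert system. Then $(Y,T)$ has an almost 1-1 extension $\rho:(\tilde Y,\tilde T)\to(Y,T)$ such that $(\tilde Y,\tilde T)$ is a compact group-factor of a recurrent-transitive Hilbert-representable system $(X,U)$. That is, there are systems $(X,U)$ and $(\tilde Y,\tilde T)$, with $(X,U)$ metrizable, recurrent-transitive and Hilbert-representable, and homomorphisms $\pi:(X,U)\to(Y,T)$, $\sigma:(X,U)\to(\tilde Y,\tilde T)$ and $\rho:(\tilde Y,\tilde T)\to(Y,T)$ such that $\pi=\rho\circ\sigma$, $\sigma$ is a group-extension and $\rho$ is an almost 1-1 extension. -/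

import Mathlib

open Topology BoundedContinuousFunction

/-! A dynamical system `(X, T)` is a compact Hausdorff space `X` with a homeomorphism `T : X ≃ₜ X`;
the `n`-th iterate of `T`, for `n : ℤ`, is the power `T ^ n` in the group `X ≃ₜ X`. -/

namespace HilbertDynamics

section Systems

variable {X Y : Type*} [TopologicalSpace X] [TopologicalSpace Y]

/-- `x` is a transitive point: its two-sided orbit is dense. -/
def IsTransitivePoint (T : X ≃ₜ X) (x : X) : Prop :=
  Dense (Set.range fun n : ℤ => (T ^ n) x)

/-- A point-transitive system. -/
def IsPointTransitive (T : X ≃ₜ X) : Prop :=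
  ∃ x, IsTransitivePoint T x

/-- A recurrent-transitive system: point-transitive, with no isolated points. -/
def IsRecurrentTransitive (T : X ≃ₜ X) : Prop :=
  IsPointTransitive T ∧ ∀ x : X, ¬ IsOpen ({x} : Set X)

/-- A homomorphism (factor map, extension) `π : (X, T) → (Y, S)`. -/
structure IsHomomorphism (T : X ≃ₜ X) (S : Y ≃ₜ Y) (π : X → Y) : Prop where
  continuous : Continuous π
  surjective : Function.Surjective π
  equivariant : ∀ x, π (T x) = S (π x)

/-- An almost 1-1 extension: over a dense `G_δ` set of points `x` of `X`, the fibre of `π` through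
`x` is `{x}`. -/
def IsAlmostOneToOneExtension (T : X ≃ₜ X) (S : Y ≃ₜ Y) (π : X → Y) : Prop :=
  IsHomomorphism T S π ∧
    ∃ X₀ : Set X, IsGδ X₀ ∧ Dense X₀ ∧ ∀ x ∈ X₀, π ⁻¹' {π x} = {x}

/-- The partition of `X` into the orbits of a group `K` of homeomorphisms of `X`. -/
def orbitSetoid (K : Subgroup (X ≃ₜ X)) : Setoid X where
  r x y := ∃ k ∈ K, k x = y
  iseqv :=
    { refl := fun x => ⟨1, K.one_mem, rfl⟩
      symm := by
        rintro x y ⟨k, hk, rfl⟩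
        exact ⟨k⁻¹, K.inv_mem hk, k.symm_apply_apply x⟩
      trans := by
        rintro x y z ⟨k, hk, rfl⟩ ⟨l, hl, rfl⟩
        exact ⟨l * k, K.mul_mem hl hk, rfl⟩ }

/-- A set of homeomorphisms of `X` is compact in `Homeo X`. For compact Hausdorff `X` the topology
of `Homeo X` (uniform convergence) is the one induced by the compact-open topology of `C(X, X)`. -/
def IsCompactInHomeo (K : Set (X ≃ₜ X)) : Prop :=
  IsCompact ((fun k : X ≃ₜ X => (⟨k, k.continuous⟩ : C(X, X))) '' K)

/-- A group-extension: `σ` is, up to an isomorphism `X / K ≅ Y`, the quotient map of `X` by a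
compact group `K` of automorphisms of `(X, T)`. The isomorphism `φ` intertwines the map induced
by `T` on `X / K` with `S`, because `σ` is a homomorphism. -/
def IsGroupExtension (T : X ≃ₜ X) (S : Y ≃ₜ Y) (σ : X → Y) : Prop :=
  IsHomomorphism T S σ ∧
    ∃ K : Subgroup (X ≃ₜ X), IsCompactInHomeo (K : Set (X ≃ₜ X)) ∧
      (∀ k ∈ K, T * k = k * T) ∧
      ∃ φ : Quotient (orbitSetoid K) ≃ₜ Y, ∀ x, φ (Quotient.mk (orbitSetoid K) x) = σ x

/-- A metric system is Hilbert-representable if it is isomorphic to the restriction of a unitary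
operator `U` of a complex Hilbert space `H` to a weakly compact `U`-invariant subset `Z` of `H`.
(`H` may be taken in the lowest universe: a metrizable weakly compact set spans a separable
Hilbert space.) -/
def IsHilbertRepresentable (T : X ≃ₜ X) : Prop :=
  TopologicalSpace.MetrizableSpace X ∧
    ∃ (H : Type) (_ : NormedAddCommGroup H) (_ : InnerProductSpace ℂ H) (_ : CompleteSpace H)
      (U : H ≃ₗᵢ[ℂ] H) (Z : Set (WeakSpace ℂ H)),
      IsCompact Z ∧
      (fun z => toWeakSpace ℂ H (U ((toWeakSpace ℂ H).symm z))) '' Z = Z ∧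
      ∃ φ : X ≃ₜ Z, ∀ x,
        (φ (T x) : WeakSpace ℂ H) = toWeakSpace ℂ H (U ((toWeakSpace ℂ H).symm (φ x)))

end Systems

/-! The Banach space `ℓ_∞(ℤ)`, with the sup norm, is `ℤ →ᵇ ℂ` (`ℤ` is discrete). -/

section Functions

open MeasureTheory

/-- The circle `ℝ / 2πℤ` (on which `fourier n t` is `e^{int}`). -/
abbrev CircleGroup : Type := AddCircle (2 * Real.pi)

noncomputable section

/-- The Fourier-Stieltjes transform `n ↦ ∫ e^{int} dμ(t)` of a complex measure on the circle. -/
def fourierStieltjes (μ : ComplexMeasure CircleGroup) (n : ℤ) : ℂ :=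
  VectorMeasure.integral μ (fun t : CircleGroup => fourier n t) (ContinuousLinearMap.mul ℝ ℂ)

/-- `B(ℤ)`: the Fourier-Stieltjes transforms of complex measures on the circle. -/
def FourierStieltjesFunctions : Set (ℤ →ᵇ ℂ) :=
  {f | ∃ μ : ComplexMeasure CircleGroup, ∀ n, f n = fourierStieltjes μ n}

/-- `H(ℤ)`: the norm closure of `B(ℤ)` in `ℓ_∞(ℤ)`; its elements are the Hilbert functions. -/
def HilbertFunctions : Set (ℤ →ᵇ ℂ) := closure FourierStieltjesFunctions

variable {X : Type*} [TopologicalSpace X] [CompactSpace X]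

/-- The function `n ↦ F (T^n x₀)` on `ℤ`, for `F ∈ C(X)`. -/
def orbitFunction (T : X ≃ₜ X) (x₀ : X) (F : C(X, ℂ)) : ℤ →ᵇ ℂ :=
  (BoundedContinuousFunction.mkOfCompact F).compContinuous
    ⟨fun n : ℤ => (T ^ n) x₀, continuous_of_discreteTopology⟩

/-- The algebra `𝒜(X, x₀)` of all functions `n ↦ F (T^n x₀)`, `F ∈ C(X)`. -/
def orbitAlgebra (T : X ≃ₜ X) (x₀ : X) : Set (ℤ →ᵇ ℂ) :=
  Set.range (orbitFunction T x₀)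

/-- `(X, T)` is a Hilbert system: for some transitive point `x₀`, all elements of `𝒜(X, x₀)` are
Hilbert functions. -/
def IsHilbertSystem (T : X ≃ₜ X) : Prop :=
  ∃ x₀, IsTransitivePoint T x₀ ∧ orbitAlgebra T x₀ ⊆ HilbertFunctions

end

end Functions

end HilbertDynamics

open HilbertDynamics

/-!
# Hilbert systems below Hilbert-representable ones

Let `y₀` be a transitive point of `Y` along which all functions of `C(Y)` are uniform limits of
Fourier-Stieltjes transforms. Countably many complex measures suffice to approximate a dense
sequence of `C(Y)`; let `ν` be a finite positive measure on the circle dominating multiples of all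
their variations. On `H = L²(ν)` let `U` be multiplication by `e^{it}`, with cyclic vector `1`; each
transform involved is `n ↦ ℓ (U ^ n 1)` for some `ℓ` in the dual of `H`. The closure `S` of the
powers of `U` in the weak operator topology is a compact metrizable commutative semitopological
monoid, and `U ^ n ↦ T ^ n y₀` extends to a continuous map `θ : S → Y`
(`exists_unitary_of_orbitAlgebra_subset`).

The set `θ⁻¹(y₀)` is a closed subsemigroup of `S`. Its smallest ideal `K` is a compact group, with
an idempotent `u` as identity (`exists_isCompactSubgroupAt_ideal`). The extension `X` is the ideal
`u S`, on which `S` acts by multiplication: it embeds in `H` by `s ↦ s 1`, hence is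
Hilbert-representable, `K` acts on it by automorphisms, and the fibre of `θ : u S → Y` over `y₀` is
`K` itself. So `X / K → Y` is one-to-one over the orbit of `y₀`, hence almost 1-1, and an
isolated point of `X` would make `K` open and `y₀` isolated
(`exists_groupExtension_of_monothetic`). That `K` is compact in the group of homeomorphisms of
`X` results from the joint continuity of multiplication on `K × S`, which holds because weak and
norm convergence agree for `k ↦ k* y`, `k ∈ K` (`continuous_mul_of_isCompactSubgroupAt`).
-/

namespace HilbertDynamics

/-! ### Compact spaces and Hilbert-representability -/

/-- In a compact metrizable space, the points at which a continuous map is injective form a `G_δ`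
set: its complement is the countable union over `n` of the compact sets of points sharing their
image with a point at distance at least `1 / (n + 1)`. -/
theorem isGδ_setOf_preimage_image_eq_singleton {A B : Type*} [TopologicalSpace A] [CompactSpace A]
    [TopologicalSpace.MetrizableSpace A] [TopologicalSpace B] [T2Space B] {f : A → B}
    (hf : Continuous f) : IsGδ {a | f ⁻¹' {f a} = {a}} := by
  let := TopologicalSpace.metrizableSpaceMetric A
  let C : ℕ → Set (A × A) := fun n => {p | f p.1 = f p.2 ∧ 1 / ((n : ℝ) + 1) ≤ dist p.1 p.2}
  have hC : ∀ n, IsClosed (Prod.fst '' C n) := fun n => by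
    have h1 : IsClosed {p : A × A | f p.1 = f p.2} := isClosed_eq (by fun_prop) (by fun_prop)
    have h2 : IsClosed {p : A × A | 1 / ((n : ℝ) + 1) ≤ dist p.1 p.2} :=
      isClosed_le (by fun_prop) (by fun_prop)
    exact ((h1.inter h2).isCompact.image continuous_fst).isClosed
  have : {a | f ⁻¹' {f a} = {a}} = ⋂ n, (Prod.fst '' C n)ᶜ := by
    ext a
    simp only [Set.mem_ofPred_eq, Set.mem_iInter, Set.mem_compl_iff]
    constructor
    · rintro h n ⟨⟨a', b⟩, ⟨h1, h2⟩, rfl⟩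
      have hb : b ∈ f ⁻¹' {f a'} := h1.symm
      rw [h] at hb
      have hb : b = a' := hb
      subst hb
      have : (0 : ℝ) < 1 / ((n : ℝ) + 1) := by positivity
      simp only [dist_self] at h2
      linarith
    · intro h
      refine Set.eq_singleton_iff_unique_mem.2 ⟨rfl, fun b hb => ?_⟩
      by_contra hne
      obtain ⟨n, hn⟩ := exists_nat_one_div_lt (dist_pos.2 (Ne.symm hne))
      exact h n ⟨(a, b), ⟨(show f b = f a from hb).symm, hn.le⟩, rfl⟩
  rw [this]
  exact IsGδ.iInter_of_isOpen fun n => (hC n).isOpen_compl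

/-- A map `h` defined along a dense family `e` extends continuously to the whole space as soon as
sufficiently many functions of `h` to separate points extend, up to arbitrarily small errors. The
extension is the map whose graph is the closure of the set of pairs `(e n, h n)`. -/
theorem exists_continuous_extension_of_approx {ι S Y : Type*} [TopologicalSpace S] [CompactSpace S]
    [T2Space S] [TopologicalSpace Y] [CompactSpace Y] [T2Space Y] {e : ι → S} (he : DenseRange e)
    (h : ι → Y)
    (H : ∀ y y' : Y, y ≠ y' → ∃ F : C(Y, ℂ), F y ≠ F y' ∧
      ∀ ε > 0, ∃ φ : C(S, ℂ), ∀ n, ‖φ (e n) - F (h n)‖ ≤ ε) :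
    ∃ θ : S → Y, Continuous θ ∧ ∀ n, θ (e n) = h n := by
  let G : Set (S × Y) := closure (Set.range fun n => (e n, h n))
  have hGc : CompactSpace G := isCompact_iff_compactSpace.1 isClosed_closure.isCompact
  have hmem : ∀ n, (e n, h n) ∈ G := fun n => subset_closure ⟨n, rfl⟩
  let p : G → S := fun q => q.1.1
  have hp : Continuous p := by fun_prop
  have hps : Function.Surjective p := by
    have h1 : IsClosed (Set.range p) := (isCompact_range hp).isClosed
    have h2 : Set.range e ⊆ Set.range p := by
      rintro _ ⟨n, rfl⟩
      exact ⟨⟨_, hmem n⟩, rfl⟩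
    exact fun s => h1.closure_subset_iff.2 h2 (he s)
  have hpi : Function.Injective p := by
    rintro ⟨⟨s, y⟩, hy⟩ ⟨⟨s', y'⟩, hy'⟩ hss
    have hss : s = s' := hss
    subst hss
    by_contra hne
    obtain ⟨F, hF, hφ⟩ := H y y' (fun h => hne (by subst h; rfl))
    have hpos : 0 < ‖F y - F y'‖ := norm_pos_iff.2 (sub_ne_zero.2 hF)
    obtain ⟨φ, hφ⟩ := hφ (‖F y - F y'‖ / 3) (by positivity)
    have hcl : ∀ q ∈ G, ‖φ q.1 - F q.2‖ ≤ ‖F y - F y'‖ / 3 := by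
      have : IsClosed {q : S × Y | ‖φ q.1 - F q.2‖ ≤ ‖F y - F y'‖ / 3} :=
        isClosed_le (by fun_prop) (by fun_prop)
      refine fun q hq => this.closure_subset_iff.2 ?_ hq
      rintro _ ⟨n, rfl⟩
      exact hφ n
    have h1 := hcl _ hy
    have h2 := hcl _ hy'
    have h3 : ‖F y - F y'‖ ≤ ‖φ s - F y‖ + ‖φ s - F y'‖ := by
      have := norm_sub_le (φ s - F y') (φ s - F y)
      rw [show φ s - F y' - (φ s - F y) = F y - F y' by ring] at this
      linarith
    simp only at h1 h2
    linarith
  let P : G ≃ₜ S := hp.isClosedEmbedding hpi |>.isEmbedding.toHomeomorphOfSurjective hps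
  refine ⟨fun s => (P.symm s).1.2, by fun_prop, fun n => ?_⟩
  have : P.symm (e n) = ⟨_, hmem n⟩ := P.symm_apply_eq.2 rfl
  simp [this]

/-- A compact system that maps injectively and equivariantly into a Hilbert space, continuously for
the weak topology, is Hilbert-representable. -/
theorem IsHilbertRepresentable.of_injective {X : Type*} [TopologicalSpace X] [CompactSpace X]
    [TopologicalSpace.MetrizableSpace X] {T : X ≃ₜ X} {H : Type} [NormedAddCommGroup H]
    [InnerProductSpace ℂ H] [CompleteSpace H] (U : H ≃ₗᵢ[ℂ] H) (f : X → H)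
    (hf : Continuous fun x => toWeakSpace ℂ H (f x)) (hinj : Function.Injective f)
    (hT : ∀ x, f (T x) = U (f x)) : IsHilbertRepresentable T := by
  have hemb := hf.isClosedEmbedding ((toWeakSpace ℂ H).injective.comp hinj)
  refine ⟨inferInstance, H, inferInstance, inferInstance, inferInstance, U,
    Set.range fun x => toWeakSpace ℂ H (f x), isCompact_range hf, ?_,
    hemb.isEmbedding.toHomeomorph, fun x => ?_⟩
  · rw [← Set.range_comp, ← T.surjective.range_comp (fun x => toWeakSpace ℂ H (f x))]
    congr 1
    ext x
    simp [hT]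
  · change toWeakSpace ℂ H (f (T x)) =
      toWeakSpace ℂ H (U ((toWeakSpace ℂ H).symm (toWeakSpace ℂ H (f x))))
    simp [hT]

/-! ### The smallest ideal of a compact commutative semigroup -/

section Kernel

variable {S : Type*} [CommMonoid S] [TopologicalSpace S]

/-- `K` is a compact subgroup of the semigroup `S`, with identity `u`, which is an idempotent of `S`
and need not be the unit of `S`. -/
structure IsCompactSubgroupAt (K : Set S) (u : S) : Prop where
  isCompact : IsCompact K
  one_mem : u ∈ K
  mul_mem : ∀ k ∈ K, ∀ l ∈ K, k * l ∈ K
  one_mul : ∀ k ∈ K, u * k = k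
  exists_inv : ∀ k ∈ K, ∃ l ∈ K, k * l = u

/-- A compact commutative semitopological semigroup `A` has a smallest ideal, which is a compact
group: it is the intersection `K` of the principal ideals `p A`, and `K = k A` for each `k ∈ K`. -/
theorem exists_isCompactSubgroupAt_ideal [CompactSpace S] [T2Space S] [SeparatelyContinuousMul S]
    {A : Set S} (hA : IsClosed A) (hne : A.Nonempty) (hmul : ∀ p ∈ A, ∀ q ∈ A, p * q ∈ A) :
    ∃ (K : Set S) (u : S), IsCompactSubgroupAt K u ∧ K ⊆ A ∧ ∀ p ∈ A, p * u ∈ K := by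
  let I : A → Set S := fun p => (fun q => (p : S) * q) '' A
  have hIc : ∀ p, IsCompact (I p) := fun p => hA.isCompact.image (continuous_const_mul _)
  have : Nonempty A := hne.to_subtype
  obtain ⟨k, hk⟩ : (⋂ p, I p).Nonempty := by
    refine IsCompact.nonempty_iInter_of_directed_nonempty_isCompact_isClosed I ?_
      (fun p => hne.image _) hIc fun p => (hIc p).isClosed
    intro p q
    refine ⟨⟨p * q, hmul _ p.2 _ q.2⟩, ?_, ?_⟩
    · rintro _ ⟨r, hr, rfl⟩
      exact ⟨q * r, hmul _ q.2 _ hr, (mul_assoc _ _ _).symm⟩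
    · rintro _ ⟨r, hr, rfl⟩
      exact ⟨p * r, hmul _ p.2 _ hr, by simp only; rw [← mul_assoc, mul_comm (q : S)]⟩
  set K : Set S := ⋂ p, I p with hK
  have hKA : K ⊆ A := by
    intro l hl
    obtain ⟨p⟩ := this
    obtain ⟨q, hq, rfl⟩ := Set.mem_iInter.1 hl p
    exact hmul _ p.2 _ hq
  have hideal : ∀ l ∈ K, ∀ q ∈ A, l * q ∈ K := by
    refine fun l hl q hq => Set.mem_iInter.2 fun p => ?_
    obtain ⟨r, hr, rfl⟩ := Set.mem_iInter.1 hl p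
    exact ⟨r * q, hmul _ hr _ hq, (mul_assoc _ _ _).symm⟩
  -- Any `l ∈ K` is divisible in `A` by any `p ∈ A`.
  have hdiv : ∀ p ∈ A, ∀ l ∈ K, ∃ q ∈ A, p * q = l := fun p hp l hl =>
    Set.mem_iInter.1 hl ⟨p, hp⟩
  obtain ⟨t, htA, ht⟩ := hdiv (k * k) (hmul _ (hKA hk) _ (hKA hk)) k hk
  have hu : k * t ∈ K := hideal k hk t htA
  have hone : ∀ l ∈ K, k * t * l = l := by
    intro l hl
    obtain ⟨q, -, rfl⟩ := hdiv k (hKA hk) l hl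
    rw [← mul_assoc, mul_right_comm k t k, ht]
  refine ⟨K, k * t, ⟨(isClosed_iInter fun p => (hIc p).isClosed).isCompact, hu,
    fun a ha b hb => hideal a ha b (hKA hb), hone, fun l hl => ?_⟩, hKA, fun p hp => ?_⟩
  · obtain ⟨q, hq, hlq⟩ := hdiv (l * l) (hmul _ (hKA hl) _ (hKA hl)) _ hu
    exact ⟨l * q, hideal l hl q hq, by rw [← mul_assoc, hlq]⟩
  · rw [mul_comm]
    exact hideal _ hu p hp

end Kernel

/-! ### Group extensions from monothetic semigroups -/

section Monothetic

variable {S : Type*} [CommMonoid S] [TopologicalSpace S]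

/-- The ideal `u S` of an idempotent `u`, as the set of points fixed by `u`. -/
abbrev FixedIdeal (u : S) : Type _ := {s : S // u * s = s}

/-- Multiplication by a unit `g` on the ideal `u S`. -/
def translation [SeparatelyContinuousMul S] (g : Sˣ) (u : S) : FixedIdeal u ≃ₜ FixedIdeal u where
  toFun s := ⟨g * s, by rw [mul_left_comm, s.2]⟩
  invFun s := ⟨(g⁻¹ : Sˣ) * s, by rw [mul_left_comm, s.2]⟩
  left_inv s := by simp
  right_inv s := by simp
  continuous_toFun := by fun_prop
  continuous_invFun := by fun_prop

@[simp]
theorem coe_translation_apply [SeparatelyContinuousMul S] (g : Sˣ) (u : S) (s : FixedIdeal u) :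
    (translation g u s : S) = g * s := rfl

theorem coe_translation_zpow_apply [SeparatelyContinuousMul S] (g : Sˣ) (u : S) (n : ℤ)
    (s : FixedIdeal u) :
    ((translation g u ^ n) s : S) = (g ^ n : Sˣ) * s := by
  have : translation g u ^ n = translation (g ^ n) u := by
    let φ : Sˣ →* (FixedIdeal u ≃ₜ FixedIdeal u) :=
      { toFun := fun g => translation g u
        map_one' := by ext; simp
        map_mul' := fun a b => by ext; simp [mul_assoc] }
    exact (map_zpow φ g n).symm
  rw [this, coe_translation_apply]

/-- Multiplication on the ideal `u S` by an element `k` of `S` that has an inverse `l` relative to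
the idempotent `u`. -/
def relTranslation [SeparatelyContinuousMul S] (u k l : S) (hkl : k * l = u) :
    FixedIdeal u ≃ₜ FixedIdeal u where
  toFun s := ⟨k * s, by rw [mul_left_comm, s.2]⟩
  invFun s := ⟨l * s, by rw [mul_left_comm, s.2]⟩
  left_inv s := by ext; simp only; rw [← mul_assoc, mul_comm l, hkl, s.2]
  right_inv s := by ext; simp only; rw [← mul_assoc, hkl, s.2]
  continuous_toFun := by fun_prop
  continuous_invFun := by fun_prop

/-- The group of homeomorphisms of `u S` given by multiplication by the elements of a compact
subgroup `K` of `S` with identity `u`. -/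
def IsCompactSubgroupAt.homeoGroup {K : Set S} {u : S} (hK : IsCompactSubgroupAt K u) :
    Subgroup (FixedIdeal u ≃ₜ FixedIdeal u) where
  carrier := {h | ∃ k ∈ K, ∀ s, (h s : S) = k * s}
  one_mem' := ⟨u, hK.one_mem, fun s => s.2.symm⟩
  mul_mem' := by
    rintro a b ⟨k, hk, hka⟩ ⟨l, hl, hlb⟩
    exact ⟨k * l, hK.mul_mem k hk l hl, fun s => by rw [Homeomorph.mul_apply, hka, hlb, mul_assoc]⟩
  inv_mem' := by
    rintro a ⟨k, hk, hka⟩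
    obtain ⟨l, hl, hkl⟩ := hK.exists_inv k hk
    refine ⟨l, hl, fun s => ?_⟩
    obtain ⟨t, rfl⟩ := a.surjective s
    rw [show a⁻¹ (a t) = t from a.symm_apply_apply t, hka, ← mul_assoc, mul_comm l, hkl, t.2]

theorem IsCompactSubgroupAt.exists_mem_homeoGroup [SeparatelyContinuousMul S] {K : Set S}
    {u : S} (hK : IsCompactSubgroupAt K u) {k : S} (hk : k ∈ K) :
    ∃ h ∈ hK.homeoGroup, ∀ s, (h s : S) = k * s := by
  obtain ⟨l, -, hkl⟩ := hK.exists_inv k hk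
  exact ⟨relTranslation u k l hkl, ⟨k, hk, fun s => rfl⟩, fun s => rfl⟩

theorem IsCompactSubgroupAt.isCompactInHomeo [SeparatelyContinuousMul S] {K : Set S}
    {u : S} (hK : IsCompactSubgroupAt K u) (hJ : Continuous fun p : K × S => (p.1 : S) * p.2) :
    IsCompactInHomeo (hK.homeoGroup : Set (FixedIdeal u ≃ₜ FixedIdeal u)) := by
  have : CompactSpace K := isCompact_iff_compactSpace.1 hK.isCompact
  let m : C(K × FixedIdeal u, FixedIdeal u) :=
    { toFun := fun p => ⟨p.1 * p.2, by rw [mul_left_comm, p.2.2]⟩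
      continuous_toFun := by
        have : Continuous fun p : K × FixedIdeal u => (p.1, (p.2 : S)) := by fun_prop
        exact (hJ.comp this).subtype_mk _ }
  have : (fun k : FixedIdeal u ≃ₜ FixedIdeal u =>
      (⟨k, k.continuous⟩ : C(FixedIdeal u, FixedIdeal u))) '' hK.homeoGroup =
      Set.range m.curry := by
    ext f
    constructor
    · rintro ⟨h, ⟨k, hk, hhk⟩, rfl⟩
      exact ⟨⟨k, hk⟩, ContinuousMap.ext fun s => Subtype.ext (hhk s).symm⟩
    · rintro ⟨k, rfl⟩
      obtain ⟨h, hh, hhk⟩ := hK.exists_mem_homeoGroup k.2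
      exact ⟨h, hh, ContinuousMap.ext fun s => Subtype.ext (hhk s)⟩
  rw [IsCompactInHomeo, this]
  exact isCompact_range m.curry.continuous

theorem IsCompactSubgroupAt.isOpenQuotientMap_mk {K : Set S} {u : S}
    (hK : IsCompactSubgroupAt K u) :
    IsOpenQuotientMap (Quotient.mk (orbitSetoid hK.homeoGroup)) := by
  refine ⟨Quotient.mk_surjective, continuous_quot_mk, fun V hV => ?_⟩
  -- The saturation of `V` is a union of translates of `V`.
  have : Quotient.mk (orbitSetoid hK.homeoGroup) ⁻¹' (Quotient.mk _ '' V) =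
      ⋃ h : hK.homeoGroup, (h : FixedIdeal u ≃ₜ FixedIdeal u) ⁻¹' V := by
    ext s
    simp only [Set.mem_preimage, Set.mem_image, Set.mem_iUnion]
    constructor
    · rintro ⟨t, ht, hts⟩
      obtain ⟨h, hh, rfl⟩ := Quotient.exact hts
      exact ⟨⟨h⁻¹, inv_mem hh⟩, by rwa [show h⁻¹ (h t) = t from h.symm_apply_apply t]⟩
    · rintro ⟨h, hs⟩
      exact ⟨_, hs, Quotient.sound ((orbitSetoid hK.homeoGroup).symm ⟨h, h.2, rfl⟩)⟩
  refine isQuotientMap_quotient_mk'.isOpen_preimage.1 ?_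
  exact this ▸ isOpen_iUnion fun h => hV.preimage h.1.continuous

theorem IsCompactSubgroupAt.t2Space_quotient [CompactSpace S] [T2Space S]
    [SeparatelyContinuousMul S] {K : Set S} {u : S} (hK : IsCompactSubgroupAt K u)
    (hJ : Continuous fun p : K × S => (p.1 : S) * p.2) :
    T2Space (Quotient (orbitSetoid hK.homeoGroup)) := by
  rw [t2Space_iff_of_isOpenQuotientMap hK.isOpenQuotientMap_mk]
  have : CompactSpace K := isCompact_iff_compactSpace.1 hK.isCompact
  -- The orbit relation is the trace on `u S` of the compact set of all `(s, k s)`, `k ∈ K`.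
  have hR : IsClosed (Set.range fun p : K × S => (p.2, (p.1 : S) * p.2)) :=
    (isCompact_range (continuous_snd.prodMk hJ)).isClosed
  have hc : Continuous fun q : FixedIdeal u × FixedIdeal u => ((q.1 : S), (q.2 : S)) := by fun_prop
  convert hR.preimage hc using 1
  ext ⟨s, t⟩
  constructor
  · intro h
    obtain ⟨a, ⟨k, hk, hak⟩, hat⟩ := Quotient.exact h
    exact ⟨(⟨k, hk⟩, s), Prod.ext rfl ((hak s).symm.trans (congrArg Subtype.val hat))⟩
  · rintro ⟨⟨k, s'⟩, h⟩
    obtain ⟨a, ha, hak⟩ := hK.exists_mem_homeoGroup k.2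
    simp only [Prod.mk.injEq] at h
    obtain ⟨rfl, h2⟩ := h
    exact Quotient.sound ⟨a, ha, Subtype.ext ((hak s).trans h2)⟩

end Monothetic

/-- Let `S` be a compact metrizable commutative semitopological monoid, monothetic with generator
`g`, such that multiplication is jointly continuous on `K × S` for each compact subgroup `K`, and
let `θ` be a continuous map of `S` to `Y` sending `g ^ n` to `T ^ n y₀`. Then the system
`(u S, g)`, with `u` the idempotent of the smallest ideal `K` of the semigroup `θ⁻¹(y₀)`,
is recurrent-transitive, and its quotient by `K` is an almost 1-1 extension of `(Y, T)`. -/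
theorem exists_groupExtension_of_monothetic {S : Type} [CommMonoid S] [TopologicalSpace S]
    [CompactSpace S] [TopologicalSpace.MetrizableSpace S] [SeparatelyContinuousMul S] (g : Sˣ)
    (hg : DenseRange fun n : ℤ => ((g ^ n : Sˣ) : S))
    (hJ : ∀ (K : Set S) (u : S), IsCompactSubgroupAt K u →
      Continuous fun p : K × S => (p.1 : S) * p.2)
    {Y : Type*} [TopologicalSpace Y] [T2Space Y] (T : Y ≃ₜ Y)
    (hT : ∀ y : Y, ¬ IsOpen ({y} : Set Y)) {y₀ : Y} (hy₀ : IsTransitivePoint T y₀) {θ : S → Y}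
    (hθ : Continuous θ) (hθg : ∀ n : ℤ, θ (g ^ n : Sˣ) = (T ^ n) y₀) :
    ∃ (u : S) (Y' : Type) (_ : TopologicalSpace Y') (_ : CompactSpace Y') (_ : T2Space Y')
      (T' : Y' ≃ₜ Y') (π : FixedIdeal u → Y) (σ : FixedIdeal u → Y') (ρ : Y' → Y),
      IsClosed {s : S | u * s = s} ∧ IsRecurrentTransitive (translation g u) ∧
      IsHomomorphism (translation g u) T π ∧
      IsGroupExtension (translation g u) T' σ ∧
      IsAlmostOneToOneExtension T' T ρ ∧
      π = ρ ∘ σ := by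
  -- Multiplication on `S` covers the action of `T` on `Y`, and respects the fibres of `θ`.
  have hθT : ∀ (n : ℤ) (s : S), θ ((g ^ n : Sˣ) * s) = (T ^ n) (θ s) := by
    intro n
    refine congrFun (hg.equalizer (by fun_prop) (by fun_prop) (funext fun m => ?_))
    simp only [Function.comp_apply]
    rw [← Units.val_mul, ← zpow_add, hθg, hθg, zpow_add, Homeomorph.mul_apply]
  have hθmul : ∀ p p' : S, θ p = θ p' → ∀ q, θ (q * p) = θ (q * p') := by
    intro p p' hpp
    refine congrFun (hg.equalizer (by fun_prop) (by fun_prop) (funext fun n => ?_))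
    simp only [Function.comp_apply, hθT, hpp]
  have hθ1 : θ 1 = y₀ := by simpa using hθg 0
  -- The stabilizer `θ⁻¹(y₀)` of `y₀` is a closed subsemigroup.
  have hmulA : ∀ p ∈ θ ⁻¹' {y₀}, ∀ q ∈ θ ⁻¹' {y₀}, p * q ∈ θ ⁻¹' {y₀} := by
    intro p hp q hq
    have : θ (p * q) = θ (p * 1) := hθmul q 1 (hq.trans hθ1.symm) p
    rw [mul_one] at this
    exact this.trans hp
  obtain ⟨K, u, hK, hKA, hKu⟩ := exists_isCompactSubgroupAt_ideal
    (IsClosed.preimage hθ (isClosed_singleton (x := y₀))) ⟨1, hθ1⟩ hmulA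
  have hJK := hJ K u hK
  have huu : u * u = u := hK.one_mul u hK.one_mem
  have hθu : θ u = y₀ := hKA hK.one_mem
  have hclosed : IsClosed {s : S | u * s = s} := isClosed_eq (by fun_prop) continuous_id
  have : CompactSpace (FixedIdeal u) := isCompact_iff_compactSpace.1 hclosed.isCompact
  let e : FixedIdeal u := ⟨u, huu⟩
  -- `u` is a transitive point of `u S`, because `S → u S` is onto and `g` generates `S`.
  have hdense : IsTransitivePoint (translation g u) e := by
    let r : S → FixedIdeal u := fun s => ⟨s * u, by rw [mul_left_comm, huu]⟩
    have hr : Continuous r := by fun_prop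
    have hrs : Function.Surjective r := fun s => ⟨s, Subtype.ext ((mul_comm _ _).trans s.2)⟩
    have := hrs.denseRange.comp hg hr
    have h : r ∘ (fun n : ℤ => ((g ^ n : Sˣ) : S)) = fun n : ℤ => (translation g u ^ n) e :=
      funext fun n => Subtype.ext (coe_translation_zpow_apply g u n e).symm
    exact (h ▸ this : DenseRange _)
  let π : FixedIdeal u → Y := fun s => θ s
  have hπ : Continuous π := by fun_prop
  have hπT : ∀ (n : ℤ) s, π ((translation g u ^ n) s) = (T ^ n) (π s) := fun n s => by
    simp only [π, coe_translation_zpow_apply, hθT]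
  have hπe : π e = y₀ := hθu
  have hπs : Function.Surjective π := by
    have h1 : IsClosed (Set.range π) := (isCompact_range hπ).isClosed
    refine fun y => h1.closure_subset_iff.2 ?_ (hy₀ y)
    rintro _ ⟨n, rfl⟩
    exact ⟨(translation g u ^ n) e, by rw [hπT, hπe]⟩
  have hhom : IsHomomorphism (translation g u) T π := ⟨hπ, hπs, fun s => by simpa using hπT 1 s⟩
  -- The fibre of `π` over `y₀` is the orbit of `u` under `K`.
  have hfib : ∀ s : FixedIdeal u, π s = y₀ ↔ (s : S) ∈ K := fun s => by
    refine ⟨fun h => ?_, fun h => hKA h⟩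
    have := hKu s h
    rwa [mul_comm, s.2] at this
  have hKθ : ∀ k ∈ K, ∀ s, θ (k * s) = θ s := fun k hk s => by
    have := hθmul k 1 ((hKA hk : θ k = y₀).trans hθ1.symm) s
    rwa [mul_one, mul_comm] at this
  have hrec : IsRecurrentTransitive (translation g u) := by
    refine ⟨⟨e, hdense⟩, fun x hx => ?_⟩
    obtain ⟨_, hn, n, rfl⟩ := hdense.inter_open_nonempty _ hx ⟨x, rfl⟩
    -- An isolated point of `u S` lies on the orbit of `u`, so that `u` is isolated; hence so is
    -- each point of `K`, and the complement of the fibre over `y₀` is closed.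
    have hopen : ∀ k : FixedIdeal u, (k : S) ∈ K → IsOpen ({k} : Set (FixedIdeal u)) := by
      intro k hk
      obtain ⟨h, -, hhk⟩ := hK.exists_mem_homeoGroup hk
      have hek : h e = k := Subtype.ext ((hhk e).trans ((mul_comm _ _).trans (hK.one_mul _ hk)))
      have hn : (translation g u ^ n) e = x := hn
      rw [← hn, ← Set.image_singleton, Homeomorph.isOpen_image] at hx
      rw [← hek, ← Set.image_singleton, Homeomorph.isOpen_image]
      exact hx
    have h1 : IsOpen (π ⁻¹' {y₀}) := by
      rw [← Set.biUnion_of_singleton (π ⁻¹' {y₀})]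
      exact isOpen_biUnion fun k hk => hopen k ((hfib k).1 hk)
    have h2 : IsClosed (π '' (π ⁻¹' {y₀})ᶜ) := (h1.isClosed_compl.isCompact.image hπ).isClosed
    rw [← Set.preimage_compl, Set.image_preimage_eq _ hπs] at h2
    exact hT y₀ (isClosed_compl_iff.1 h2)
  have hT2 := hK.t2Space_quotient hJK
  have hQ := hK.isOpenQuotientMap_mk
  have hcomm : ∀ h ∈ hK.homeoGroup, translation g u * h = h * translation g u := by
    rintro h ⟨k, hk, hhk⟩
    ext s
    simp only [Homeomorph.mul_apply, coe_translation_apply, hhk, mul_left_comm]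
  have hcomm' : ∀ h ∈ hK.homeoGroup, ∀ s, (translation g u).symm (h s) =
      h ((translation g u).symm s) := fun h hh s => by
    rw [Homeomorph.symm_apply_eq, ← Homeomorph.mul_apply, hcomm h hh, Homeomorph.mul_apply,
      Homeomorph.apply_symm_apply]
  let Q := Quotient (orbitSetoid hK.homeoGroup)
  let T' : Q ≃ₜ Q :=
    { toFun := Quotient.map (translation g u) (by
        rintro s _ ⟨h, hh, rfl⟩
        exact ⟨h, hh, by rw [← Homeomorph.mul_apply, ← hcomm h hh, Homeomorph.mul_apply]⟩)
      invFun := Quotient.map (translation g u).symm (by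
        rintro s _ ⟨h, hh, rfl⟩
        exact ⟨h, hh, (hcomm' h hh s).symm⟩)
      left_inv := by rintro ⟨s⟩; exact congrArg _ ((translation g u).symm_apply_apply s)
      right_inv := by rintro ⟨s⟩; exact congrArg _ ((translation g u).apply_symm_apply s)
      continuous_toFun := (translation g u).continuous.quotient_map' _
      continuous_invFun := (translation g u).symm.continuous.quotient_map' _ }
  let σ : FixedIdeal u → Q := Quotient.mk _
  let ρ : Q → Y := Quotient.lift π (by
    rintro s _ ⟨h, ⟨k, hk, hhk⟩, rfl⟩
    exact ((congrArg θ (hhk s)).trans (hKθ k hk s)).symm)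
  have hρ : Continuous ρ := hπ.quotient_lift _
  have hρσ : π = ρ ∘ σ := rfl
  have hsc : SecondCountableTopology Q := by
    let := TopologicalSpace.metrizableSpaceMetric S
    exact hQ.isQuotientMap.secondCountableTopology hQ.isOpenMap
  have hρT : IsHomomorphism T' T ρ := by
    refine ⟨hρ, Function.Surjective.of_comp (hρσ ▸ hπs : Function.Surjective (ρ ∘ σ)), ?_⟩
    rintro ⟨s⟩
    exact hhom.equivariant s
  refine ⟨u, Q, inferInstance, inferInstance, hT2, T', π, σ, ρ, hclosed, hrec, hhom,
    ⟨⟨hQ.continuous, hQ.surjective, fun s => rfl⟩, hK.homeoGroup, hK.isCompactInHomeo hJK, hcomm,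
      Homeomorph.refl _, fun s => rfl⟩,
    ⟨hρT, _, isGδ_setOf_preimage_image_eq_singleton hρ, ?_, fun q hq => hq⟩, hρσ⟩
  -- Over the dense orbit of `y₀` the fibres of `ρ` are points.
  refine (hQ.surjective.denseRange.comp hdense hQ.continuous).mono ?_
  rintro _ ⟨n, rfl⟩
  refine Set.eq_singleton_iff_unique_mem.2 ⟨rfl, ?_⟩
  rintro ⟨s⟩ hs
  have hs : π s = π ((translation g u ^ n) e) := hs
  rw [hπT, hπe] at hs
  obtain ⟨t, ht⟩ : ∃ t, t = (translation g u ^ (-n)) s := ⟨_, rfl⟩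
  have htK : (t : S) ∈ K := (hfib t).1 (by
    rw [ht, hπT, hs, ← Homeomorph.mul_apply, ← zpow_add, neg_add_cancel, zpow_zero,
      Homeomorph.one_apply])
  have hst : s = (translation g u ^ n) t := by
    rw [ht, ← Homeomorph.mul_apply, ← zpow_add, add_neg_cancel, zpow_zero, Homeomorph.one_apply]
  obtain ⟨h, hh, hht⟩ := hK.exists_mem_homeoGroup htK
  refine Quotient.sound ((orbitSetoid hK.homeoGroup).symm ⟨h, hh, Subtype.ext ?_⟩)
  calc (h ((translation g u ^ n) e) : S) = (g ^ n : Sˣ) * (u * t) := by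
        rw [hht, coe_translation_zpow_apply, mul_left_comm, mul_comm u]
    _ = s := by rw [t.2, ← coe_translation_zpow_apply, ← hst]

/-! ### The enveloping semigroup of a unitary operator -/

section Operators

open Filter
open scoped InnerProductSpace

variable {H : Type*} [NormedAddCommGroup H] [InnerProductSpace ℂ H]

/-- A unitary operator, as an invertible element of the ring of operators with the weak operator
topology. -/
noncomputable def unitaryWOT (U : H ≃ₗᵢ[ℂ] H) : (H →WOT[ℂ] H)ˣ where
  val := .ofCLM (U : H →L[ℂ] H)
  inv := .ofCLM (U.symm : H →L[ℂ] H)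
  val_inv := by ext; simp
  inv_val := by ext; simp

@[simp]
theorem unitaryWOT_apply (U : H ≃ₗᵢ[ℂ] H) (x : H) :
    (unitaryWOT U : H →WOT[ℂ] H) x = U x := rfl

theorem unitaryWOT_zpow (U : H ≃ₗᵢ[ℂ] H) (n : ℤ) : unitaryWOT U ^ n = unitaryWOT (U ^ n) := by
  let φ : (H ≃ₗᵢ[ℂ] H) →* (H →WOT[ℂ] H)ˣ :=
    { toFun := unitaryWOT
      map_one' := by ext; rfl
      map_mul' := fun a b => by ext; rfl }
  exact (map_zpow φ U n).symm

/-- The closure of the powers of a unitary operator in the weak operator topology, the enveloping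
semigroup of the systems that the operator defines. -/
noncomputable def envelope (U : H ≃ₗᵢ[ℂ] H) : Submonoid (H →WOT[ℂ] H) :=
  ((Subgroup.zpowers (unitaryWOT U)).toSubmonoid.map (Units.coeHom _)).topologicalClosure

theorem coe_envelope (U : H ≃ₗᵢ[ℂ] H) : (envelope U : Set (H →WOT[ℂ] H)) =
    closure (Set.range fun n : ℤ => ((unitaryWOT U ^ n : (H →WOT[ℂ] H)ˣ) : H →WOT[ℂ] H)) := by
  rw [envelope, Submonoid.coe_topologicalClosure]
  congr 1
  ext A
  simp [Subgroup.mem_zpowers_iff]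

theorem zpow_mem_envelope (U : H ≃ₗᵢ[ℂ] H) (n : ℤ) :
    ((unitaryWOT U ^ n : (H →WOT[ℂ] H)ˣ) : H →WOT[ℂ] H) ∈ envelope U := by
  rw [← SetLike.mem_coe, coe_envelope]
  exact subset_closure ⟨n, rfl⟩

noncomputable instance (U : H ≃ₗᵢ[ℂ] H) : CommMonoid (envelope U) where
  toMonoid := (envelope U).toMonoid
  mul_comm := by
    refine (Submonoid.commMonoidTopologicalClosure _ ?_).mul_comm
    rintro ⟨_, a, ⟨m, rfl⟩, rfl⟩ ⟨_, b, ⟨n, rfl⟩, rfl⟩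
    refine Subtype.ext ?_
    simp only [Submonoid.coe_mul, Units.coeHom_apply, ← Units.val_mul, ← zpow_add, add_comm]

instance (U : H ≃ₗᵢ[ℂ] H) : SeparatelyContinuousMul (envelope U) where
  continuous_const_mul := ((continuous_const_mul _).comp continuous_subtype_val).subtype_mk _
  continuous_mul_const := ((continuous_mul_const _).comp continuous_subtype_val).subtype_mk _

/-- The generator `U` of the semigroup `envelope U`. -/
noncomputable def envelopeGen (U : H ≃ₗᵢ[ℂ] H) : (envelope U)ˣ where
  val := ⟨unitaryWOT U, by simpa using zpow_mem_envelope U 1⟩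
  inv := ⟨((unitaryWOT U)⁻¹ : (H →WOT[ℂ] H)ˣ), by simpa using zpow_mem_envelope U (-1)⟩
  val_inv := Subtype.ext (unitaryWOT U).val_inv
  inv_val := Subtype.ext (unitaryWOT U).inv_val

theorem coe_envelopeGen_zpow (U : H ≃ₗᵢ[ℂ] H) (n : ℤ) :
    (((envelopeGen U ^ n : (envelope U)ˣ) : envelope U) : H →WOT[ℂ] H) = unitaryWOT (U ^ n) := by
  have h := congrArg Units.val (map_zpow (Units.map (envelope U).subtype) (envelopeGen U) n)
  have hg : Units.map (envelope U).subtype (envelopeGen U) = unitaryWOT U := Units.ext rfl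
  rw [hg, unitaryWOT_zpow] at h
  exact h

theorem denseRange_envelopeGen_zpow (U : H ≃ₗᵢ[ℂ] H) :
    DenseRange fun n : ℤ => ((envelopeGen U ^ n : (envelope U)ˣ) : envelope U) := by
  rw [DenseRange, Subtype.dense_iff, ← Set.range_comp]
  refine (coe_envelope U).subset.trans (subset_of_eq ?_)
  simp only [Function.comp_def, coe_envelopeGen_zpow, unitaryWOT_zpow]

/-- Evaluation at a vector is continuous from the enveloping semigroup to the weak topology. -/
theorem continuous_toWeakSpace_envelope_apply (U : H ≃ₗᵢ[ℂ] H) (x : H) :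
    Continuous fun s : envelope U => toWeakSpace ℂ H ((s : H →WOT[ℂ] H) x) := by
  refine WeakBilin.continuous_of_continuous_eval _ fun y => ?_
  exact (ContinuousLinearMapWOT.continuous_dual_apply x y).comp continuous_subtype_val

/-- The operators in the enveloping semigroup of `U` commute with `U`, so that they are determined
by their value at a cyclic vector. -/
theorem injective_envelope_apply {U : H ≃ₗᵢ[ℂ] H} {x : H}
    (hx : (Submodule.span ℂ (Set.range fun n : ℤ => (U ^ n) x)).topologicalClosure = ⊤) :
    Function.Injective fun s : envelope U => (s : H →WOT[ℂ] H) x := by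
  intro s t hst
  have hst : (s : H →WOT[ℂ] H) x = (t : H →WOT[ℂ] H) x := hst
  have hcomm : ∀ (s : envelope U) (n : ℤ), (s : H →WOT[ℂ] H) ((U ^ n) x) =
      (U ^ n) ((s : H →WOT[ℂ] H) x) := fun s n => by
    have := congrArg (fun r : envelope U => (r : H →WOT[ℂ] H) x)
      (mul_comm s (envelopeGen U ^ n : (envelope U)ˣ))
    rw [← unitaryWOT_apply (U ^ n), ← unitaryWOT_apply (U ^ n), ← coe_envelopeGen_zpow]
    exact this
  have : (s : H →WOT[ℂ] H).toCLM = (t : H →WOT[ℂ] H).toCLM := by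
    refine ContinuousLinearMap.ext_on (s := Set.range fun n : ℤ => (U ^ n) x) ?_ ?_
    · rwa [← Submodule.dense_iff_topologicalClosure_eq_top] at hx
    · rintro _ ⟨n, rfl⟩
      simp only [ContinuousLinearMapWOT.toCLM_apply, hcomm, hst]
  exact Subtype.ext (ContinuousLinearMapWOT.toCLM_injective this)

variable [CompleteSpace H]

/-- The contractions of a Hilbert space are compact in the weak operator topology: along an
ultrafilter of contractions `A`, the numbers `⟪A v, w⟫` converge to a bounded sesquilinear form. -/
theorem isCompact_setOf_contraction : IsCompact {A : H →WOT[ℂ] H | ∀ x, ‖A x‖ ≤ ‖x‖} := by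
  rw [isCompact_iff_ultrafilter_le_nhds]
  intro f hf
  have hlim : ∀ v w : H, ∃ c : ℂ, ‖c‖ ≤ 1 * ‖v‖ * ‖w‖ ∧
      Tendsto (fun A : H →WOT[ℂ] H => ⟪A v, w⟫_ℂ) f (𝓝 c) := by
    intro v w
    obtain ⟨c, hc, hfc⟩ := (isCompact_closedBall (0 : ℂ) (1 * ‖v‖ * ‖w‖)).ultrafilter_le_nhds
      (f.map fun A : H →WOT[ℂ] H => ⟪A v, w⟫_ℂ) (by
        refine le_principal_iff.2 (mem_map.2 (mem_of_superset (le_principal_iff.1 hf) ?_))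
        intro A hA
        refine mem_closedBall_zero_iff.2 ((norm_inner_le_norm _ _).trans ?_)
        rw [one_mul]
        exact mul_le_mul_of_nonneg_right (hA v) (norm_nonneg w))
    exact ⟨c, by simpa using hc, hfc⟩
  choose B hBn hB using hlim
  let B' : H →ₗ⋆[ℂ] H →ₗ[ℂ] ℂ := LinearMap.mk₂'ₛₗ (starRingEnd ℂ) (RingHom.id ℂ) B
    (fun v v' w => tendsto_nhds_unique (hB _ _) (by
      simpa [inner_add_left] using (hB v w).add (hB v' w)))
    (fun c v w => tendsto_nhds_unique (hB _ _) (by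
      simpa only [ContinuousLinearMapWOT.coe_toCLM, map_smul, inner_smul_left,
        smul_eq_mul] using
        (hB v w).const_mul (starRingEnd ℂ c)))
    (fun v w w' => tendsto_nhds_unique (hB _ _) (by
      simpa [inner_add_right] using (hB v w).add (hB v w')))
    (fun c v w => tendsto_nhds_unique (hB _ _) (by
      simpa [inner_smul_right] using (hB v w).const_mul _))
  let A₀ : H →L[ℂ] H :=
    InnerProductSpace.continuousLinearMapOfBilin (B'.mkContinuous₂ 1 hBn)
  have hA₀ : ∀ v w, ⟪A₀ v, w⟫_ℂ = B v w := fun v w =>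
    InnerProductSpace.continuousLinearMapOfBilin_apply _ v w
  refine ⟨.ofCLM A₀, fun x => ?_, ?_⟩
  · change ‖A₀ x‖ ≤ ‖x‖
    have h := hBn x (A₀ x)
    rw [← hA₀, inner_self_eq_norm_sq_to_K, one_mul] at h
    have h' : ‖A₀ x‖ * ‖A₀ x‖ ≤ ‖x‖ * ‖A₀ x‖ := by simpa [sq] using h
    rcases (norm_nonneg (A₀ x)).eq_or_lt with h0 | h0
    · rw [← h0]
      exact norm_nonneg x
    · exact le_of_mul_le_mul_right h' h0
  · rw [ContinuousLinearMapWOT.le_nhds_iff_forall_inner_apply_le_nhds]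
    intro x y
    have := (hB x y).star
    rw [← hA₀] at this
    simpa [Tendsto] using this

theorem star_unitaryWOT (U : H ≃ₗᵢ[ℂ] H) :
    star (unitaryWOT U : H →WOT[ℂ] H) = unitaryWOT U⁻¹ := by
  refine ContinuousLinearMapWOT.ext_inner fun x y => ?_
  rw [ContinuousLinearMapWOT.star_apply, ContinuousLinearMap.star_eq_adjoint,
    ContinuousLinearMap.adjoint_inner_right]
  exact (U.inner_map_eq_flip y x)

theorem norm_envelope_apply_le {U : H ≃ₗᵢ[ℂ] H} {A : H →WOT[ℂ] H} (hA : A ∈ envelope U) (x : H) :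
    ‖A x‖ ≤ ‖x‖ := by
  rw [← SetLike.mem_coe, coe_envelope] at hA
  refine (isCompact_setOf_contraction (H := H)).isClosed.closure_subset_iff.2 ?_ hA x
  rintro _ ⟨n, rfl⟩ x
  simp only [unitaryWOT_zpow, unitaryWOT_apply, LinearIsometryEquiv.norm_map, le_refl]

instance (U : H ≃ₗᵢ[ℂ] H) : CompactSpace (envelope U) :=
  isCompact_iff_compactSpace.1 (isCompact_setOf_contraction.of_isClosed_subset
    (Submonoid.isClosed_topologicalClosure _) fun _ hA => norm_envelope_apply_le hA)

theorem star_mem_envelope {U : H ≃ₗᵢ[ℂ] H} {A : H →WOT[ℂ] H} (hA : A ∈ envelope U) :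
    star A ∈ envelope U := by
  rw [← SetLike.mem_coe, coe_envelope] at hA ⊢
  refine map_mem_closure continuous_star hA ?_
  rintro _ ⟨n, rfl⟩
  refine ⟨-n, ?_⟩
  simp only [unitaryWOT_zpow, star_unitaryWOT, ← zpow_neg]

/-- On a compact subgroup `K` of the enveloping semigroup, all operators have the same initial
projection `k* k = u* u`. -/
theorem star_mul_self_eq_of_mem {U : H ≃ₗᵢ[ℂ] H} {K : Set (envelope U)} {u : envelope U}
    (hK : IsCompactSubgroupAt K u) {k : envelope U} (hk : k ∈ K) :
    star (k : H →WOT[ℂ] H) * k = star (u : H →WOT[ℂ] H) * u := by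
  have hn : ∀ x, ‖(k : H →WOT[ℂ] H) x‖ = ‖(u : H →WOT[ℂ] H) x‖ := by
    intro x
    obtain ⟨l, -, hkl⟩ := hK.exists_inv k hk
    apply le_antisymm
    · have : (k : H →WOT[ℂ] H) x = (k : H →WOT[ℂ] H) ((u : H →WOT[ℂ] H) x) := by
        conv_lhs => rw [← hK.one_mul k hk, mul_comm]
        rfl
      rw [this]
      exact norm_envelope_apply_le k.2 _
    · have : (u : H →WOT[ℂ] H) x = (l : H →WOT[ℂ] H) ((k : H →WOT[ℂ] H) x) := by
        rw [← hkl, mul_comm]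
        rfl
      rw [this]
      exact norm_envelope_apply_le l.2 _
  have hstar : ∀ A : H →WOT[ℂ] H, ∀ x y, ⟪y, (star A * A) x⟫_ℂ = ⟪A y, A x⟫_ℂ := fun A x y => by
    rw [ContinuousLinearMapWOT.mul_apply, ContinuousLinearMapWOT.star_apply,
      ContinuousLinearMap.star_eq_adjoint, ContinuousLinearMap.adjoint_inner_right]
    rfl
  -- `k` and `u` have the same norms on vectors; conclude by polarization.
  refine ContinuousLinearMapWOT.ext_inner fun x y => ?_
  rw [hstar, hstar]
  simp only [inner_eq_sum_norm_sq_div_four, ← map_add, ← map_sub, ← map_smul, hn]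

/-- Multiplication on the enveloping semigroup of a unitary operator is jointly continuous on
`K × envelope U` for each compact subgroup `K`: on `K` the map `k ↦ k* y` is norm-continuous. -/
theorem continuous_mul_of_isCompactSubgroupAt {U : H ≃ₗᵢ[ℂ] H} {K : Set (envelope U)}
    {u : envelope U} (hK : IsCompactSubgroupAt K u) :
    Continuous fun p : K × envelope U => (p.1 : envelope U) * p.2 := by
  have hadj : ∀ (A : H →WOT[ℂ] H) (x y : H), ⟪y, A x⟫_ℂ = ⟪star A y, x⟫_ℂ := fun A x y => by
    rw [ContinuousLinearMapWOT.star_apply, ContinuousLinearMap.star_eq_adjoint,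
      ContinuousLinearMap.adjoint_inner_left]
    rfl
  have hcoe : Continuous fun k : K => ((k : envelope U) : H →WOT[ℂ] H) := by fun_prop
  -- `k k* = k* k = u* u` for `k ∈ K`, by commutativity of the enveloping semigroup.
  have hnormal : ∀ k ∈ K, (k : H →WOT[ℂ] H) * star (k : H →WOT[ℂ] H) =
      star (u : H →WOT[ℂ] H) * u := fun k hk => by
    rw [← star_mul_self_eq_of_mem hK hk]
    exact congrArg Subtype.val (mul_comm k ⟨_, star_mem_envelope k.2⟩)
  have hnorm : ∀ (y : H) (k₀ : K), Tendsto
      (fun k : K => ‖star ((k : envelope U) : H →WOT[ℂ] H) y -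
        star ((k₀ : envelope U) : H →WOT[ℂ] H) y‖) (𝓝 k₀) (𝓝 0) := by
    intro y k₀
    -- The norm of `k* y` does not depend on `k`, so weak continuity implies norm continuity.
    have h1 : ∀ k : K, ‖star ((k : envelope U) : H →WOT[ℂ] H) y -
        star ((k₀ : envelope U) : H →WOT[ℂ] H) y‖ ^ 2 =
        2 * (Complex.re ⟪y, (star (u : H →WOT[ℂ] H) * u) y⟫_ℂ - Complex.re ⟪y,
          ((k : envelope U) : H →WOT[ℂ] H) (star ((k₀ : envelope U) : H →WOT[ℂ] H) y)⟫_ℂ) := by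
      intro k
      have h2 : ∀ k : K, ‖star ((k : envelope U) : H →WOT[ℂ] H) y‖ ^ 2 =
          Complex.re ⟪y, (star (u : H →WOT[ℂ] H) * u) y⟫_ℂ := fun k => by
        rw [← hnormal k k.2, ContinuousLinearMapWOT.mul_apply, hadj, inner_self_eq_norm_sq_to_K]
        norm_cast
      rw [@norm_sub_sq ℂ, h2, h2, hadj ((k : envelope U) : H →WOT[ℂ] H)]
      simp only [RCLike.re_to_complex]
      ring
    have h3 : Tendsto (fun k : K => ‖star ((k : envelope U) : H →WOT[ℂ] H) y -
        star ((k₀ : envelope U) : H →WOT[ℂ] H) y‖ ^ 2) (𝓝 k₀) (𝓝 0) := by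
      have hc : Continuous fun k : K => 2 * (Complex.re ⟪y, (star (u : H →WOT[ℂ] H) * u) y⟫_ℂ -
          Complex.re ⟪y, ((k : envelope U) : H →WOT[ℂ] H)
            (star ((k₀ : envelope U) : H →WOT[ℂ] H) y)⟫_ℂ) := by
        have := ContinuousLinearMapWOT.continuous_inner_apply hcoe
          (star ((k₀ : envelope U) : H →WOT[ℂ] H) y) y
        exact continuous_const.mul (continuous_const.sub (Complex.continuous_re.comp this))
      have := hc.tendsto k₀
      simp only [h1]
      convert this using 2
      rw [← hnormal k₀ k₀.2, ContinuousLinearMapWOT.mul_apply, sub_self, mul_zero]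
    have := h3.sqrt
    simpa using this
  refine Continuous.subtype_mk (ContinuousLinearMapWOT.continuous_iff.2 fun x y => ?_) _
  refine continuous_iff_continuousAt.2 fun ⟨k₀, s₀⟩ => ?_
  have heq : ∀ p : K × envelope U,
      ⟪y, ((((p.1 : envelope U) * p.2 : envelope U)) : H →WOT[ℂ] H) x⟫_ℂ =
      ⟪star ((p.1 : envelope U) : H →WOT[ℂ] H) y - star ((k₀ : envelope U) : H →WOT[ℂ] H) y,
        (p.2 : H →WOT[ℂ] H) x⟫_ℂ +
      ⟪star ((k₀ : envelope U) : H →WOT[ℂ] H) y, (p.2 : H →WOT[ℂ] H) x⟫_ℂ := fun p => by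
    rw [inner_sub_left, sub_add_cancel, ← hadj]
    rfl
  have hfst : Tendsto (fun p : K × envelope U =>
      ⟪star ((p.1 : envelope U) : H →WOT[ℂ] H) y - star ((k₀ : envelope U) : H →WOT[ℂ] H) y,
        (p.2 : H →WOT[ℂ] H) x⟫_ℂ) (𝓝 (k₀, s₀)) (𝓝 0) := by
    have hb := ((hnorm y k₀).comp (continuous_fst.tendsto (k₀, s₀))).mul_const ‖x‖
    rw [zero_mul] at hb
    refine squeeze_zero_norm (fun p => ?_) hb
    exact (norm_inner_le_norm _ _).trans
      (mul_le_mul_of_nonneg_left (norm_envelope_apply_le p.2.2 x) (norm_nonneg _))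
  have hsnd : Continuous fun p : K × envelope U =>
      ⟪star ((k₀ : envelope U) : H →WOT[ℂ] H) y, (p.2 : H →WOT[ℂ] H) x⟫_ℂ :=
    ContinuousLinearMapWOT.continuous_inner_apply
      (continuous_subtype_val.comp continuous_snd) _ _
  have := hfst.add (hsnd.tendsto (k₀, s₀))
  simp only [← heq] at this
  rw [ContinuousAt]
  rw [zero_add, ← hadj] at this
  exact this

/-- With a cyclic vector `x`, the coefficients `⟪U ^ n x, s x⟫` determine `s`, and embed the
enveloping semigroup into `ℤ → ℂ`. -/
theorem metrizableSpace_envelope {U : H ≃ₗᵢ[ℂ] H} {x : H}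
    (hx : (Submodule.span ℂ (Set.range fun n : ℤ => (U ^ n) x)).topologicalClosure = ⊤) :
    TopologicalSpace.MetrizableSpace (envelope U) := by
  let c : envelope U → ℤ → ℂ := fun s n => ⟪(U ^ n) x, (s : H →WOT[ℂ] H) x⟫_ℂ
  have hc : Continuous c := continuous_pi fun n =>
    ContinuousLinearMapWOT.continuous_inner_apply continuous_subtype_val _ _
  have hci : Function.Injective c := by
    intro s t hst
    refine injective_envelope_apply hx ?_
    refine (Submodule.dense_iff_topologicalClosure_eq_top.2 hx).eq_of_inner_right (𝕜 := ℂ) ?_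
    intro v hv
    induction hv using Submodule.span_induction with
    | mem v hv =>
      obtain ⟨n, rfl⟩ := hv
      exact congrFun hst n
    | zero => simp
    | add v w _ _ hv hw => rw [inner_add_left, inner_add_left, hv, hw]
    | smul a v _ hv => rw [inner_smul_left, inner_smul_left, hv]
  exact (hc.isClosedEmbedding hci).isEmbedding.metrizableSpace

end Operators

/-! ### Fourier-Stieltjes transforms and multiplication by characters on `L²(ν)` -/

section Measures

open MeasureTheory
open scoped ENNReal NNReal

instance fact_zero_lt_two_pi : Fact (0 < 2 * Real.pi) := ⟨Real.two_pi_pos⟩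

theorem norm_fourier_apply (n : ℤ) (t : CircleGroup) : ‖fourier n t‖ = 1 := by
  rw [fourier_apply]
  exact Circle.norm_coe _

/-- A countable family of finite measures is dominated, up to constants, by one finite measure. -/
theorem exists_isFiniteMeasure_forall_le_smul {α ι : Type*} [MeasurableSpace α] [Countable ι]
    (m : ι → Measure α) [∀ i, IsFiniteMeasure (m i)] :
    ∃ ν : Measure α, IsFiniteMeasure ν ∧ ∀ i, ∃ C : ℝ≥0, m i ≤ C • ν := by
  obtain ⟨δ, hδ, hsum⟩ := ENNReal.exists_pos_tsum_mul_lt_of_countable one_ne_zero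
    (fun i => m i Set.univ) fun i => measure_ne_top _ _
  refine ⟨Measure.sum fun i => δ i • m i, ⟨?_⟩, fun i => ⟨(δ i)⁻¹, ?_⟩⟩
  · rw [Measure.sum_apply _ MeasurableSet.univ]
    refine lt_of_eq_of_lt (tsum_congr fun i => ?_) (hsum.trans ENNReal.one_lt_top)
    rw [Measure.smul_apply, ENNReal.smul_def, smul_eq_mul, mul_comm]
  · calc m i = (δ i)⁻¹ • (δ i • m i) := by rw [smul_smul, inv_mul_cancel₀ (hδ i).ne', one_smul]
      _ ≤ (δ i)⁻¹ • Measure.sum fun i => δ i • m i := by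
        gcongr
        exact Measure.le_sum (fun i => δ i • m i) i

/-- Integration against a complex measure is a bounded functional on `L²(ν)`, when the finite
measure `ν` dominates a multiple of the variation. -/
theorem exists_continuousLinearMap_eq_integral {α : Type*} [TopologicalSpace α] [CompactSpace α]
    [MeasurableSpace α] [BorelSpace α] (μ : ComplexMeasure α) [IsFiniteMeasure μ.variation]
    {ν : Measure α} [IsFiniteMeasure ν] {C : ℝ≥0} (hC : μ.variation ≤ C • ν) :
    ∃ ℓ : Lp ℂ 2 ν →L[ℂ] ℂ, ∀ φ : C(α, ℂ), ℓ (ContinuousMap.toLp 2 ν ℂ φ) =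
      VectorMeasure.integral μ φ (ContinuousLinearMap.mul ℝ ℂ) := by
  have hac : μ.variation ≪ ν := Measure.absolutelyContinuous_of_le_smul hC
  have hL2 : ∀ f : Lp ℂ 2 ν, MemLp f 2 μ.variation := fun f =>
    ((Lp.memLp f).smul_measure ENNReal.coe_ne_top).mono_measure hC
  have hL1 : ∀ f : Lp ℂ 2 ν, Integrable f μ.variation := fun f => (hL2 f).integrable one_le_two
  let L : Lp ℂ 2 ν →ₗ[ℂ] ℂ :=
    { toFun := fun f => VectorMeasure.integral μ f (ContinuousLinearMap.mul ℝ ℂ)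
      map_add' := fun f g => by
        rw [← VectorMeasure.integral_add (hL1 f) (hL1 g)]
        exact VectorMeasure.integral_congr_ae (hac.ae_le (Lp.coeFn_add f g))
      map_smul' := fun c f => by
        rw [VectorMeasure.integral_congr_ae (hac.ae_le (Lp.coeFn_smul c f))]
        refine setToFun_smul _ (fun c s x => ?_) c f
        simp only [transpose_eq_cbmApplyMeasure, cbmApplyMeasure_apply,
          ContinuousLinearMap.mul_apply', smul_eq_mul, mul_assoc] }
  obtain ⟨M, hM⟩ : ∃ M : ℝ, ∀ f : Lp ℂ 2 ν, ∫ x, ‖f x‖ ∂μ.variation ≤ M * ‖f‖ := by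
    have hK : μ.variation Set.univ ^ (1 / (1 : ℝ≥0∞).toReal - 1 / (2 : ℝ≥0∞).toReal) ≠ ∞ :=
      ENNReal.rpow_ne_top_of_nonneg (by norm_num) (measure_ne_top _ _)
    have hC' : (C : ℝ≥0∞) ^ (1 / (2 : ℝ≥0∞)).toReal ≠ ∞ :=
      ENNReal.rpow_ne_top_of_nonneg (by norm_num) ENNReal.coe_ne_top
    refine ⟨((C : ℝ≥0∞) ^ (1 / (2 : ℝ≥0∞)).toReal * μ.variation Set.univ ^
      (1 / (1 : ℝ≥0∞).toReal - 1 / (2 : ℝ≥0∞).toReal)).toReal, fun f => ?_⟩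
    rw [integral_norm_eq_lintegral_enorm (hL1 f).1, ← eLpNorm_one_eq_lintegral_enorm,
      Lp.norm_def, ← ENNReal.toReal_mul]
    refine ENNReal.toReal_mono (ENNReal.mul_ne_top (ENNReal.mul_ne_top hC' hK)
      (Lp.eLpNorm_ne_top f)) ?_
    calc eLpNorm f 1 μ.variation
        ≤ eLpNorm f 2 μ.variation * μ.variation Set.univ ^
            (1 / (1 : ℝ≥0∞).toReal - 1 / (2 : ℝ≥0∞).toReal) :=
          eLpNorm_le_eLpNorm_mul_rpow_measure_univ one_le_two (hL1 f).1
      _ ≤ eLpNorm f 2 ((C : ℝ≥0∞) • ν) * μ.variation Set.univ ^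
            (1 / (1 : ℝ≥0∞).toReal - 1 / (2 : ℝ≥0∞).toReal) := by
          gcongr
          exact hC
      _ = _ := by
          rw [eLpNorm_smul_measure_of_ne_top (by norm_num), smul_eq_mul, mul_right_comm]
  refine ⟨L.mkContinuous (‖ContinuousLinearMap.mul ℝ ℂ‖ * M) fun f => ?_, fun φ => ?_⟩
  · rw [mul_assoc]
    exact VectorMeasure.norm_integral_le_integral_norm.trans
      (mul_le_mul_of_nonneg_left (hM f) (ContinuousLinearMap.opNorm_nonneg _))
  · exact VectorMeasure.integral_congr_ae (hac.ae_le (ContinuousMap.coeFn_toLp ν φ))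

/-- Each Fourier-Stieltjes transform is of the form `n ↦ ℓ (e^{int})` for a bounded functional `ℓ`
on `L²(ν)`, whenever `ν` dominates a multiple of a suitable finite measure. -/
theorem exists_measure_forall_le_smul_exists_fourierStieltjes_eq (μ : ComplexMeasure CircleGroup) :
    ∃ m : Measure CircleGroup, IsFiniteMeasure m ∧ ∀ (ν : Measure CircleGroup) [IsFiniteMeasure ν]
      (C : ℝ≥0), m ≤ C • ν → ∃ ℓ : Lp ℂ 2 ν →L[ℂ] ℂ, ∀ n : ℤ,
        ℓ (ContinuousMap.toLp 2 ν ℂ (fourier n)) = fourierStieltjes μ n := by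
  by_cases hμ : IsFiniteMeasure μ.variation
  · refine ⟨μ.variation, hμ, fun ν _ C hC => ?_⟩
    obtain ⟨ℓ, hℓ⟩ := exists_continuousLinearMap_eq_integral μ hC
    exact ⟨ℓ, fun n => hℓ (fourier n)⟩
  · -- For a vector measure of infinite variation the integral is `0` by convention, so that no
    -- appeal to the finiteness of the variation of a complex measure is needed.
    refine ⟨0, inferInstance, fun ν _ C _ => ⟨0, fun n => ?_⟩⟩
    refine (VectorMeasure.integral_undef fun h => hμ ?_).symm
    have h1 : Integrable (fun _ : CircleGroup => (1 : ℝ)) μ.variation :=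
      h.norm.congr (Filter.Eventually.of_forall fun t => norm_fourier_apply n t)
    exact (integrable_const_iff_isFiniteMeasure one_ne_zero).1 h1

section FourierMultiplication

variable (ν : Measure CircleGroup)

theorem memLp_fourier_mul (n : ℤ) (f : Lp ℂ 2 ν) : MemLp (fun t => fourier n t * f t) 2 ν :=
  (Lp.memLp f).congr_norm ((map_continuous (fourier n)).aestronglyMeasurable.mul
    (Lp.memLp f).1) (Filter.Eventually.of_forall fun t => by
      rw [norm_mul, norm_fourier_apply, one_mul])

/-- Multiplication by the character `e^{int}` on `L²(ν)`. -/
noncomputable def fourierMul (n : ℤ) : Lp ℂ 2 ν →ₗ[ℂ] Lp ℂ 2 ν where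
  toFun f := (memLp_fourier_mul ν n f).toLp
  map_add' f g := by
    rw [← MemLp.toLp_add]
    refine MemLp.toLp_congr _ _ ?_
    filter_upwards [Lp.coeFn_add f g] with t ht
    rw [ht, Pi.add_apply, Pi.add_apply, mul_add]
  map_smul' c f := by
    rw [RingHom.id_apply, ← MemLp.toLp_const_smul]
    refine MemLp.toLp_congr _ _ ?_
    filter_upwards [Lp.coeFn_smul c f] with t ht
    rw [ht, Pi.smul_apply, Pi.smul_apply, smul_eq_mul, smul_eq_mul, mul_left_comm]

theorem coeFn_fourierMul (n : ℤ) (f : Lp ℂ 2 ν) :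
    fourierMul ν n f =ᵐ[ν] fun t => fourier n t * f t :=
  (memLp_fourier_mul ν n f).coeFn_toLp

theorem fourierMul_fourierMul (m n : ℤ) (f : Lp ℂ 2 ν) :
    fourierMul ν m (fourierMul ν n f) = fourierMul ν (m + n) f := by
  refine Lp.ext ?_
  filter_upwards [coeFn_fourierMul ν m (fourierMul ν n f), coeFn_fourierMul ν n f,
    coeFn_fourierMul ν (m + n) f] with t h1 h2 h3
  rw [h1, h2, h3, fourier_add, mul_assoc]

theorem fourierMul_zero (f : Lp ℂ 2 ν) : fourierMul ν 0 f = f := by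
  refine Lp.ext ?_
  filter_upwards [coeFn_fourierMul ν 0 f] with t h
  rw [h, fourier_zero, one_mul]

theorem norm_fourierMul (n : ℤ) (f : Lp ℂ 2 ν) : ‖fourierMul ν n f‖ = ‖f‖ := by
  rw [Lp.norm_def, Lp.norm_def]
  congr 1
  refine eLpNorm_congr_norm_ae ?_
  filter_upwards [coeFn_fourierMul ν n f] with t h
  rw [h, norm_mul, norm_fourier_apply, one_mul]

/-- Multiplication by `e^{it}`, as a unitary operator of `L²(ν)`. -/
noncomputable def fourierUnitary : Lp ℂ 2 ν ≃ₗᵢ[ℂ] Lp ℂ 2 ν where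
  toLinearEquiv := LinearEquiv.ofLinearMap (fourierMul ν 1) (fourierMul ν (-1))
    (LinearMap.ext fun f => (fourierMul_fourierMul ν 1 (-1) f).trans (fourierMul_zero ν f))
    (LinearMap.ext fun f => (fourierMul_fourierMul ν (-1) 1 f).trans (fourierMul_zero ν f))
  norm_map' := norm_fourierMul ν 1

theorem fourierUnitary_zpow_apply (n : ℤ) (f : Lp ℂ 2 ν) :
    (fourierUnitary ν ^ n) f = fourierMul ν n f := by
  induction n with
  | zero => exact (fourierMul_zero ν f).symm
  | succ k ih =>
    rw [add_comm, zpow_add, zpow_one, ← fourierMul_fourierMul, ← ih]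
    rfl
  | pred k ih =>
    rw [sub_eq_neg_add, zpow_add, zpow_neg_one, ← fourierMul_fourierMul, ← ih]
    rfl

variable [IsFiniteMeasure ν]

theorem fourierMul_toLp_fourier (m n : ℤ) :
    fourierMul ν m (ContinuousMap.toLp 2 ν ℂ (fourier n)) =
      ContinuousMap.toLp 2 ν ℂ (fourier (m + n)) := by
  refine Lp.ext ?_
  filter_upwards [coeFn_fourierMul ν m (ContinuousMap.toLp 2 ν ℂ (fourier n)),
    ContinuousMap.coeFn_toLp (p := 2) (𝕜 := ℂ) ν (fourier n),
    ContinuousMap.coeFn_toLp (p := 2) (𝕜 := ℂ) ν (fourier (m + n))] with t h1 h2 h3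
  rw [h1, h2, h3, fourier_add]

theorem fourierUnitary_zpow_one (n : ℤ) :
    (fourierUnitary ν ^ n) (ContinuousMap.toLp 2 ν ℂ (fourier 0)) =
      ContinuousMap.toLp 2 ν ℂ (fourier n) := by
  rw [fourierUnitary_zpow_apply, fourierMul_toLp_fourier, add_zero]

/-- The constant function `1` is a cyclic vector of multiplication by `e^{it}`. -/
theorem span_fourierUnitary_zpow_closure_eq_top :
    (Submodule.span ℂ (Set.range fun n : ℤ =>
      (fourierUnitary ν ^ n) (ContinuousMap.toLp 2 ν ℂ (fourier 0)))).topologicalClosure = ⊤ := by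
  have h := (ContinuousMap.toLp_denseRange ℂ ν ℂ
    (ENNReal.ofNat_ne_top (n := 2))).topologicalClosure_map_submodule
    (span_fourier_closure_eq_top (T := 2 * Real.pi))
  rw [Submodule.map_span, ← Set.range_comp] at h
  simp only [fourierUnitary_zpow_one]
  exact h

end FourierMultiplication

end Measures

/-! ### The enveloping semigroup above a Hilbert system -/

open MeasureTheory in
/-- If the functions `n ↦ F (T ^ n y₀)` are Hilbert functions, then `U ^ n ↦ T ^ n y₀` extends
continuously to the enveloping semigroup of some unitary operator `U` with a cyclic vector, namely
multiplication by `e^{it}` on `L²(ν)` for a measure `ν` dominating countably many measures whose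
transforms approximate these functions. -/
theorem exists_unitary_of_orbitAlgebra_subset {Y : Type*} [TopologicalSpace Y] [CompactSpace Y]
    [TopologicalSpace.MetrizableSpace Y] {T : Y ≃ₜ Y} {y₀ : Y}
    (hY : orbitAlgebra T y₀ ⊆ HilbertFunctions) :
    ∃ (H : Type) (_ : NormedAddCommGroup H) (_ : InnerProductSpace ℂ H) (_ : CompleteSpace H)
      (U : H ≃ₗᵢ[ℂ] H) (x : H) (θ : envelope U → Y),
      (Submodule.span ℂ (Set.range fun n : ℤ => (U ^ n) x)).topologicalClosure = ⊤ ∧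
      Continuous θ ∧ ∀ n : ℤ, θ (envelopeGen U ^ n : (envelope U)ˣ) = (T ^ n) y₀ := by
  let := TopologicalSpace.metrizableSpaceMetric Y
  let F : ℕ → C(Y, ℂ) := TopologicalSpace.denseSeq C(Y, ℂ)
  have hF : ∀ i k : ℕ, ∃ μ : ComplexMeasure CircleGroup, ∀ n : ℤ,
      ‖fourierStieltjes μ n - F i ((T ^ n) y₀)‖ ≤ 1 / ((k : ℝ) + 1) := by
    intro i k
    obtain ⟨f, ⟨μ, hμ⟩, hf⟩ := Metric.mem_closure_iff.1 (hY ⟨F i, rfl⟩) (1 / ((k : ℝ) + 1))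
      (by positivity)
    refine ⟨μ, fun n => ?_⟩
    rw [← hμ, ← dist_eq_norm, dist_comm]
    exact (BoundedContinuousFunction.dist_coe_le_dist (f := orbitFunction T y₀ (F i)) n).trans hf.le
  choose μ hμ using hF
  choose m hm hm' using
    fun j : ℕ × ℕ => exists_measure_forall_le_smul_exists_fourierStieltjes_eq (μ j.1 j.2)
  obtain ⟨ν, hν, hC⟩ := exists_isFiniteMeasure_forall_le_smul m
  choose C hC using hC
  choose ℓ hℓ using fun j => hm' j ν (C j) (hC j)
  obtain ⟨θ, hθ, hθg⟩ := exists_continuous_extension_of_approx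
    (denseRange_envelopeGen_zpow (fourierUnitary ν)) (fun n => (T ^ n) y₀) (by
      intro y y' hne
      -- A dense sequence in `C(Y)` separates points, since the distance to `y` does.
      obtain ⟨i, hi⟩ : ∃ i, F i y ≠ F i y' := by
        by_contra! h
        have hcl : IsClosed {G : C(Y, ℂ) | G y = G y'} :=
          isClosed_eq (continuous_eval_const y)
            (continuous_eval_const y')
        have hall := hcl.closure_subset_iff.2 (Set.range_subset_iff.2 h)
          (TopologicalSpace.denseRange_denseSeq C(Y, ℂ) ⟨fun z => (dist z y : ℂ), by fun_prop⟩)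
        have : (dist y y : ℂ) = (dist y' y : ℂ) := hall
        rw [dist_self, Complex.ofReal_inj] at this
        exact hne (dist_eq_zero.1 this.symm).symm
      refine ⟨F i, hi, fun ε hε => ?_⟩
      obtain ⟨k, hk⟩ := exists_nat_one_div_lt hε
      refine ⟨⟨fun s => ℓ (i, k) ((s : Lp ℂ 2 ν →WOT[ℂ] Lp ℂ 2 ν)
        (ContinuousMap.toLp 2 ν ℂ (fourier 0))),
        (ContinuousLinearMapWOT.continuous_dual_apply _ _).comp continuous_subtype_val⟩,
        fun n => ?_⟩
      simp only [ContinuousMap.coe_mk, coe_envelopeGen_zpow, unitaryWOT_apply,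
        fourierUnitary_zpow_one, hℓ]
      exact (hμ i k n).trans hk.le)
  exact ⟨Lp ℂ 2 ν, inferInstance, inferInstance, inferInstance, fourierUnitary ν, _, θ,
    span_fourierUnitary_zpow_closure_eq_top ν, hθ, hθg⟩

end HilbertDynamics

theorem theorem3p1 {Y : Type*} [TopologicalSpace Y] [CompactSpace Y]
    [TopologicalSpace.MetrizableSpace Y] (T : Y ≃ₜ Y)
    (hrec : IsRecurrentTransitive T) (hHilbert : IsHilbertSystem T) :
    ∃ (X Y' : Type)
      (_ : TopologicalSpace X) (_ : CompactSpace X) (_ : T2Space X)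
      (_ : TopologicalSpace Y') (_ : CompactSpace Y') (_ : T2Space Y')
      (U : X ≃ₜ X) (T' : Y' ≃ₜ Y') (π : X → Y) (σ : X → Y') (ρ : Y' → Y),
      IsRecurrentTransitive U ∧ IsHilbertRepresentable U ∧
      IsHomomorphism U T π ∧
      IsGroupExtension U T' σ ∧
      IsAlmostOneToOneExtension T' T ρ ∧
      π = ρ ∘ σ := by
  obtain ⟨y₀, hy₀, hY⟩ := hHilbert
  obtain ⟨H, _, _, _, U, x, θ, hx, hθ, hθg⟩ := exists_unitary_of_orbitAlgebra_subset hY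
  have := metrizableSpace_envelope hx
  obtain ⟨u, Y', _, _, _, T', π, σ, ρ, hu, hrec', hπ, hσ, hρ, h⟩ :=
    exists_groupExtension_of_monothetic (envelopeGen U) (denseRange_envelopeGen_zpow U)
      (fun K u hK => continuous_mul_of_isCompactSubgroupAt hK) T hrec.2 hy₀ hθ hθg
  have : CompactSpace (FixedIdeal u) := isCompact_iff_compactSpace.1 hu.isCompact
  have : TopologicalSpace.MetrizableSpace (FixedIdeal u) :=
    IsEmbedding.subtypeVal.metrizableSpace
  refine ⟨FixedIdeal u, Y', inferInstance, inferInstance, inferInstance, inferInstance,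
    inferInstance, inferInstance, translation (envelopeGen U) u, T', π, σ, ρ, hrec', ?_, hπ, hσ,
    hρ, h⟩
  exact IsHilbertRepresentable.of_injective U
    (fun s => ((s : envelope U) : H →WOT[ℂ] H) x)
    ((continuous_toWeakSpace_envelope_apply U x).comp continuous_subtype_val)
    ((injective_envelope_apply hx).comp Subtype.val_injective) fun s => rfl
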